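/- Let $G=(V,E)$ be a finite decomposable graph (every cycle of length at least $4$ has a chord), let $\mathcal I_v$, $v\in V$, be finite sets, and let $\mathcal I=\prod_{v\in V}\mathcal I_v$ be the set of cells; for $D\subset V$ write $\mathcal I_D=\prod_{v\in D}\mathcal I_v$. Let $\mathbf p=(\mathbf p(\underline i))_{\underline i\in\mathcal I}$ be a vector of random cell probabilities associated with $G$: a random vector such that almost surely $\mathbf p(\underline i)>0$ for all $\underline i\in\mathcal I$, $\sum_{\underline i}\mathbf p(\underline i)=1$, and a vector $X=(X_v)_{v\in V}$ with $\mathbb P_{\mathbf p}(X=\underline i)=\mathbf p(\underline i)$ is Markov with respect to $G$, that is, $X_u$ and $X_w$ are conditionally independent given $X_{V\setminus\{u,w\}}$ under $\mathbb P_{\mathbf p}$ for all distinct non-adjacent $u,w\in V$. A moral DAG with skeleton $G$ is given by its parent function $\mathfrak p$, $v\mapsto\mathfrak p_v\subset V$: the directed graph with arrows $u\to v$ for $u\in\mathfrak p_v$ is acyclic, its underlying undirected graph is $G$, and any two distinct parents of the same vertex are adjacent. For such $\mathfrak p$, $v\in V$ and $\underline k\in\mathcal I_{\mathfrak p_v}$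 put $$\mathbf p^{v|\mathfrak p_v}_{\cdot|\underline k}=\bigl(\mathbb P_{\mathbf p}(X_v=m\mid X_{\mathfrak p_v}=\underline k)\bigr)_{m\in\mathcal I_v}.$$ Parameter independence holds for $\mathbf p$ with respect to $\mathfrak p$ if the following random vectors are independent and non-degenerate (not almost surely constant): for each $v\in V$, the vectors $\mathbf p^{v|\mathfrak p_v}_{\cdot|\underline k}$, $\underline k\in\mathcal I_{\mathfrak p_v}$ (local independence); and the vectors $(\mathbf p^{v|\mathfrak p_v}_{\cdot|\underline k})_{\underline k\in\mathcal I_{\mathfrak p_v}}$, $v\in V$ (global independence). Let $\mathcal P$ be a family of moral DAGs with skeleton $G$ which is separating: for every $v\in V$ there are $\mathfrak p,\mathfrak p'\in\mathcal P$ with $\mathfrak p_v\neq\mathfrak p'_v$. If parameter independence holds for $\mathbf p$ with respect to every $\mathfrak p\in\mathcal P$, then $\mathbf p$ has a $\mathcal P$-Dirichlet distribution, that is, for every $\mathfrak p\in\mathcal P$, almost surely $$\mathbf p(\underline i)=\prod_{v\in V}\mathbf p^{v|\mathfrak p_v}_{i_v|\underline i_{\mathfrak p_v}}\qquad(\underline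 i\in\mathcal I),$$ and the random vectors $\mathbf p^{v|\mathfrak p_v}_{\cdot|\underline k}$, $v\in V$, $\underline k\in\mathcal I_{\mathfrak p_v}$, are jointly independent, each of them having a classical Dirichlet distribution with some positive parameters. (No density of $\mathbf p$ is assumed.) -/

import Mathlib

open MeasureTheory ProbabilityTheory

namespace PDirichlet

noncomputable section

/-! ### Graphs and DAGs -/

section Graphs

variable {V : Type*}

/-- `G` is decomposable (chordal): every cycle of length at least `4` has a chord. -/
def IsDecomposable (G : SimpleGraph V) : Prop :=
  ∀ (v : V) (c : G.Walk v v), c.IsCycle → 4 ≤ c.length → ¬ c.IsChordless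

/-- `pa` is the parent function of a moral DAG with skeleton `G`: the directed graph with the
arrows `u ⟶ v` for `u ∈ pa v` has no directed cycle, its underlying undirected graph is `G`, and
two distinct parents of the same vertex are adjacent. -/
structure IsMoralDAG (G : SimpleGraph V) (pa : V → Finset V) : Prop where
  acyclic : ∀ v, ¬ Relation.TransGen (fun u w => u ∈ pa w) v v
  skeleton : ∀ u v, G.Adj u v ↔ u ∈ pa v ∨ v ∈ pa u
  moral : ∀ w, ∀ u ∈ pa w, ∀ v ∈ pa w, u ≠ v → G.Adj u v

/-- A family of DAGs (given by their parent functions) is separating if every vertex has different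
parent sets in two members of the family. -/
def IsSeparating (P : Set (V → Finset V)) : Prop :=
  ∀ v, ∃ pa ∈ P, ∃ pa' ∈ P, pa v ≠ pa' v

end Graphs

/-! ### Cell probabilities. The set of cells is `∀ v, I v`, and `q i` is `ℙ (X = i)`. -/

section Cells

variable {V : Type*} [Fintype V] [DecidableEq V] {I : V → Type*} [∀ v, Fintype (I v)]

/-- `ℙ (X ∈ A)` under the table `q` of cell probabilities. -/
def prob (q : (∀ v, I v) → ℝ) (A : Set (∀ v, I v)) : ℝ := ∑ i, A.indicator q i

/-- `ℙ (X ∈ A | X ∈ B)`. -/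
def condProb (q : (∀ v, I v) → ℝ) (A B : Set (∀ v, I v)) : ℝ := prob q (A ∩ B) / prob q B

/-- `X` is Markov with respect to `G`: `X u` and `X w` are conditionally independent given all
the other coordinates of `X`, for any two distinct non-adjacent vertices `u` and `w`. -/
def IsMarkov (G : SimpleGraph V) (q : (∀ v, I v) → ℝ) : Prop :=
  ∀ u w, u ≠ w → ¬ G.Adj u w → ∀ i : ∀ v, I v,
    condProb q {j | j u = i u ∧ j w = i w} {j | ∀ v, v ≠ u → v ≠ w → j v = i v} =
      condProb q {j | j u = i u} {j | ∀ v, v ≠ u → v ≠ w → j v = i v} *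
        condProb q {j | j w = i w} {j | ∀ v, v ≠ u → v ≠ w → j v = i v}

/-- `ℙ (X v = m | X_{pa v} = k)`. -/
def condParam (q : (∀ v, I v) → ℝ) (pa : V → Finset V) (v : V) (k : ∀ w : pa v, I w) (m : I v) :
    ℝ :=
  condProb q {j | j v = m} {j | ∀ w : pa v, j w = k w}

end Cells

/-! ### The classical Dirichlet distribution -/

section Dirichlet

variable {ι : Type*} [Fintype ι] [DecidableEq ι]

/-- The vector with coordinates `x m` for `m ≠ m₀` whose coordinate sum is `1`. -/
def complete (m₀ : ι) (x : {m // m ≠ m₀} → ℝ) (m : ι) : ℝ :=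
  if h : m = m₀ then 1 - ∑ j, x j else x ⟨m, h⟩

open Classical in
/-- The Dirichlet density in the coordinates other than `m₀`. It is supported by
`{x | (∀ m, 0 < x m) ∧ ∑ m, x m < 1}`, i.e. by the `x` whose completion is positive. -/
def dirichletDensity (α : ι → ℝ) (m₀ : ι) (x : {m // m ≠ m₀} → ℝ) : ℝ :=
  if ∀ m, 0 < complete m₀ x m then
    Real.Gamma (∑ m, α m) / (∏ m, Real.Gamma (α m)) * ∏ m, complete m₀ x m ^ (α m - 1)
  else 0

/-- The Dirichlet distribution with parameters `α`, as a measure on `ι → ℝ` (concentrated on the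
unit simplex). -/
def dirichletMeasure (α : ι → ℝ) (m₀ : ι) : Measure (ι → ℝ) :=
  ((volume : Measure ({m // m ≠ m₀} → ℝ)).withDensity
    (fun x => ENNReal.ofReal (dirichletDensity α m₀ x))).map (complete m₀)

/-- `ν` is a classical Dirichlet distribution on the unit simplex of `ι → ℝ`, with some positive
parameters; the coordinate `m₀` which is eliminated in order to write the density is arbitrary. -/
def IsDirichlet (ν : Measure (ι → ℝ)) : Prop :=
  Nonempty ι ∧ ∃ α : ι → ℝ, (∀ m, 0 < α m) ∧ ∀ m₀, ν = dirichletMeasure α m₀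

end Dirichlet

/-! ### Random cell probabilities -/

section Random

variable {V : Type*} [Fintype V] [DecidableEq V] {I : V → Type*} [∀ v, Fintype (I v)]
  {Ω : Type*} [MeasurableSpace Ω]

/-- `p` is a vector of random (positive) cell probabilities associated with the graph `G`. -/
structure IsAssociated (G : SimpleGraph V) (p : Ω → (∀ v, I v) → ℝ) (μ : Measure Ω) : Prop where
  measurable : Measurable p
  pos : ∀ᵐ ω ∂μ, ∀ i, 0 < p ω i
  sum_eq_one : ∀ᵐ ω ∂μ, ∑ i, p ω i = 1
  markov : ∀ᵐ ω ∂μ, IsMarkov G (p ω)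

/-- A random element is non-degenerate if it is not almost surely constant. -/
def Nondegenerate {E : Type*} (Y : Ω → E) (μ : Measure Ω) : Prop :=
  ¬ ∃ c : E, ∀ᵐ ω ∂μ, Y ω = c

/-- For each vertex `v`, the random vectors `(ℙ (X v = m | X_{pa v} = k))_m`, indexed by `k`, are
independent and non-degenerate. -/
def LocalParameterIndependence (pa : V → Finset V) (p : Ω → (∀ v, I v) → ℝ) (μ : Measure Ω) :
    Prop :=
  ∀ v, iIndepFun (fun (k : ∀ w : pa v, I w) ω => condParam (p ω) pa v k) μ ∧
    ∀ k : ∀ w : pa v, I w, Nondegenerate (fun ω => condParam (p ω) pa v k) μ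

/-- The random vectors `(ℙ (X v = m | X_{pa v} = k))_{k, m}`, indexed by `v`, are independent and
non-degenerate. -/
def GlobalParameterIndependence (pa : V → Finset V) (p : Ω → (∀ v, I v) → ℝ) (μ : Measure Ω) :
    Prop :=
  iIndepFun (fun v ω => condParam (p ω) pa v) μ ∧
    ∀ v, Nondegenerate (fun ω => condParam (p ω) pa v) μ

/-- Parameter independence with respect to the DAG with parent function `pa`. -/
def ParameterIndependence (pa : V → Finset V) (p : Ω → (∀ v, I v) → ℝ) (μ : Measure Ω) : Prop :=
  LocalParameterIndependence pa p μ ∧ GlobalParameterIndependence pa p μ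

variable [∀ v, DecidableEq (I v)]

/-- `p` has a `pa`-Dirichlet distribution: it is associated with `G`, it is almost surely the
product of the conditional probabilities of each vertex given its parents, and the random vectors
`(ℙ (X v = m | X_{pa v} = k))_m`, indexed by all pairs `(v, k)`, are independent and follow
classical Dirichlet distributions. -/
structure IsDAGDirichlet (G : SimpleGraph V) (pa : V → Finset V) (p : Ω → (∀ v, I v) → ℝ)
    (μ : Measure Ω) : Prop where
  associated : IsAssociated G p μ
  rep : ∀ᵐ ω ∂μ, ∀ i, p ω i = ∏ v, condParam (p ω) pa v (fun w => i w) (i v)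
  indep : iIndepFun
    (fun (x : Σ v, ∀ w : pa v, I w) ω => condParam (p ω) pa x.1 x.2) μ
  dirichlet : ∀ v, ∀ k : ∀ w : pa v, I w, IsDirichlet (μ.map fun ω => condParam (p ω) pa v k)

/-- `p` has a `P`-Dirichlet distribution: it has a `pa`-Dirichlet distribution for each member `pa`
of the family `P`. -/
def IsFamilyDirichlet (G : SimpleGraph V) (P : Set (V → Finset V)) (p : Ω → (∀ v, I v) → ℝ)
    (μ : Measure Ω) : Prop :=
  ∀ pa ∈ P, IsDAGDirichlet G pa p μ

end Random

end

end PDirichlet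

/-! The proof compares the joint moments E ∏ p(i)^{n i}, which exist without any density, along two
DAGs. The Markov property factorizes each cell probability along a moral DAG
(`IsMarkov.eq_prod_condParam`). With parameter independence, each joint moment is then a product,
over pairs (vertex, parent configuration), of moments of the conditional laws evaluated at the
corresponding counts (`integral_prod_pow_eq_prod_moment`).

The multiplicative second difference `crossRatio` isolates one vertex `v`. Take all observations in
cells that differ from `x` only at `v`, and add one cell with value `m` at `v` and one with value
`m' ≠ m`, the second built from another cell `y`. Children of `v` see different parent
configurations and contribute 1. The other vertices contribute a function of the number of
observations. The vertex `v` contributes the cross ratio of its own conditional law if `x` and `y`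
agree on the parents of `v`, and 1 otherwise (`exists_crossRatio_sliceCount`). The joint moments do
not depend on the DAG, so two DAGs with different parents of `v` can be played against each other by
a suitable choice of `y`: the cross ratios of the conditional law at `v` depend only on the total
degree (`exists_crossRatio_of_ne`).

This is a form of Johnson's sufficientness postulate. It makes the predictive probabilities affine
in the counts (`exists_affine_predictive`). Slope zero means a constant vector, which non-degeneracy
excludes. A positive slope gives the Dirichlet moment recursion, and moments determine a law on the
cube (`isDirichlet_of_crossRatio`). -/

namespace PDirichlet

/-! ### Factorization of a positive Markov table along a moral DAG. -/

section Factorization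

variable {V : Type*} [Fintype V] [DecidableEq V] {I : V → Type*} [∀ v, Fintype (I v)]

/-- The probability that `X` agrees with `i` on `B`. -/
noncomputable def marginal (q : (∀ v, I v) → ℝ) (B : Finset V) (i : ∀ v, I v) : ℝ :=
  prob q {j | ∀ w ∈ B, j w = i w}

lemma marginal_pos {q : (∀ v, I v) → ℝ} (hq : ∀ i, 0 < q i) (B : Finset V) (i : ∀ v, I v) :
    0 < marginal q B i := by
  unfold marginal prob
  refine Finset.sum_pos' (fun j _ => Set.indicator_nonneg (fun j _ => (hq j).le) j)
    ⟨i, Finset.mem_univ _, ?_⟩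
  rw [Set.indicator_of_mem (by simp)]
  exact hq i

lemma marginal_univ (q : (∀ v, I v) → ℝ) (i : ∀ v, I v) : marginal q Finset.univ i = q i := by
  unfold marginal prob
  rw [Finset.sum_eq_single i]
  · simp
  · intro j _ hj
    refine Set.indicator_of_notMem (fun h => hj ?_) _
    rw [Set.mem_ofPred_eq] at h
    exact funext fun v => h v (Finset.mem_univ v)
  · simp

lemma marginal_empty (q : (∀ v, I v) → ℝ) (i : ∀ v, I v) : marginal q ∅ i = ∑ j, q j := by
  simp [marginal, prob]

lemma marginal_congr (q : (∀ v, I v) → ℝ) {B : Finset V} {i j : ∀ v, I v}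
    (h : ∀ w ∈ B, i w = j w) : marginal q B i = marginal q B j := by
  unfold marginal
  congr 1
  ext l
  simp only [Set.mem_ofPred_eq]
  exact forall₂_congr fun w hw => by rw [h w hw]

lemma marginal_update_of_notMem (q : (∀ v, I v) → ℝ) {B : Finset V} {w : V} (hw : w ∉ B)
    (i : ∀ v, I v) (a : I w) : marginal q B (Function.update i w a) = marginal q B i := by
  refine marginal_congr q fun u hu => Function.update_of_ne ?_ _ _
  rintro rfl
  exact hw hu

lemma marginal_eq_sum_insert (q : (∀ v, I v) → ℝ) {B : Finset V} {w : V} (hw : w ∉ B)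
    (i : ∀ v, I v) :
    marginal q B i = ∑ a, marginal q (insert w B) (Function.update i w a) := by
  classical
  unfold marginal prob
  rw [Finset.sum_comm]
  refine Finset.sum_congr rfl fun j _ => ?_
  rw [Finset.sum_eq_single (j w)]
  · simp only [Set.indicator_apply]
    refine if_congr ?_ rfl rfl
    simp only [Set.mem_ofPred_eq, Finset.forall_mem_insert, Function.update_self, true_and]
    refine forall₂_congr fun u hu => ?_
    rw [Function.update_of_ne]
    rintro rfl
    exact hw hu
  · intro a _ ha
    refine Set.indicator_of_notMem (fun h => ha ?_) _
    have := h w (Finset.mem_insert_self _ _)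
    simpa using this.symm
  · simp

lemma condParam_eq_marginal_div (q : (∀ v, I v) → ℝ) (pa : V → Finset V) (v : V)
    (i : ∀ v, I v) :
    condParam q pa v (fun w => i w) (i v) =
      marginal q (insert v (pa v)) i / marginal q (pa v) i := by
  unfold condParam condProb marginal
  congr 2
  · ext j
    simp
  · ext j
    simp

/-- The coordinates `u` and `w` have no interaction in `F`. -/
def NoInteraction (F : (∀ v, I v) → ℝ) (u w : V) : Prop :=
  ∀ i a b, F i * F (Function.update (Function.update i u a) w b) =
    F (Function.update i u a) * F (Function.update i w b)

omit [Fintype V] [∀ v, Fintype (I v)] in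
lemma NoInteraction.symm {F : (∀ v, I v) → ℝ} {u w : V} (huw : u ≠ w)
    (h : NoInteraction F u w) : NoInteraction F w u := by
  intro i a b
  rw [Function.update_comm huw.symm, h, mul_comm]

/-- Up to a factor that ignores the coordinates `u` and `w`, conditional independence writes `q` as
a product of a marginal ignoring `w` and a marginal ignoring `u`. Both sides of the four-term
identity are then the same product of four marginals. -/
lemma IsMarkov.noInteraction {G : SimpleGraph V} {q : (∀ v, I v) → ℝ} (hq : ∀ i, 0 < q i)
    (hG : IsMarkov G q) {u w : V} (huw : u ≠ w) (hadj : ¬ G.Adj u w) : NoInteraction q u w := by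
  classical
  intro i a b
  have key : ∀ j : ∀ v, I v, (∀ v, v ≠ u → v ≠ w → j v = i v) →
      q j * marginal q (Finset.univ.filter fun v => v ≠ u ∧ v ≠ w) i =
        marginal q (Finset.univ.filter fun v => v ≠ w) j *
          marginal q (Finset.univ.filter fun v => v ≠ u) j := by
    intro j hj
    have hB : prob q {l | ∀ v, v ≠ u → v ≠ w → l v = j v} =
        marginal q (Finset.univ.filter fun v => v ≠ u ∧ v ≠ w) i := by
      unfold marginal
      congr 1
      ext l
      simp only [Set.mem_ofPred_eq, Finset.mem_filter, Finset.mem_univ, true_and, and_imp]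
      exact forall_congr' fun v => forall₂_congr fun h h' => by rw [hj v h h']
    have hpos := marginal_pos hq (Finset.univ.filter fun v => v ≠ u ∧ v ≠ w) i
    have := hG u w huw hadj j
    unfold condProb at this
    rw [hB, div_mul_div_comm, div_eq_div_iff hpos.ne' (mul_pos hpos hpos).ne', ← mul_assoc,
      mul_left_inj' hpos.ne'] at this
    convert this using 2
    · rw [← marginal_univ q j]
      unfold marginal
      congr 1
      ext l
      simp only [Set.mem_ofPred_eq, Set.mem_inter_iff, Finset.mem_univ, true_imp_iff]
      refine ⟨fun h => ⟨⟨h u, h w⟩, fun v _ _ => h v⟩, fun h v => ?_⟩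
      by_cases hu : v = u
      · exact hu ▸ h.1.1
      by_cases hw : v = w
      · exact hw ▸ h.1.2
      exact h.2 v hu hw
    · unfold marginal
      congr 1
      ext l
      simp only [Set.mem_ofPred_eq, Set.mem_inter_iff]
      grind
    · unfold marginal
      congr 1
      ext l
      simp only [Set.mem_ofPred_eq, Set.mem_inter_iff]
      grind
  have hpos := marginal_pos hq (Finset.univ.filter fun v => v ≠ u ∧ v ≠ w) i
  have h1 := key i (fun _ _ _ => rfl)
  have h2 := key (Function.update (Function.update i u a) w b) (fun v h h' => by simp [h, h'])
  have h3 := key (Function.update i u a) (fun v h h' => by simp [h])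
  have h4 := key (Function.update i w b) (fun v h h' => by simp [h'])
  have e1 : ∀ (j : ∀ v, I v) (a : I u),
      marginal q (Finset.univ.filter fun v => v ≠ u) (Function.update j u a) =
        marginal q (Finset.univ.filter fun v => v ≠ u) j :=
    marginal_update_of_notMem q (by simp)
  have e2 : ∀ (j : ∀ v, I v) (b : I w),
      marginal q (Finset.univ.filter fun v => v ≠ w) (Function.update j w b) =
        marginal q (Finset.univ.filter fun v => v ≠ w) j :=
    marginal_update_of_notMem q (by simp)
  rw [e2, Function.update_comm huw, e1, Function.update_comm huw.symm] at h2
  rw [e1] at h3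
  rw [e2] at h4
  refine mul_right_cancel₀ (mul_pos hpos hpos).ne' ?_
  rw [mul_mul_mul_comm, h1, h2, mul_mul_mul_comm (q (Function.update i u a)), h3, h4]
  ring

/-- If `v` interacts within `insert v B` only with the vertices of `S ⊆ B`, then the conditional
probability of `v` given `B` is the one given `S`. -/
lemma marginal_insert_mul {q : (∀ v, I v) → ℝ} (hq : ∀ i, 0 < q i) {v : V} {B S : Finset V}
    (hv : v ∉ B) (hS : S ⊆ B)
    (hInt : ∀ w ∈ B, w ∉ S → NoInteraction (marginal q (insert v B)) v w) (i : ∀ v, I v) :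
    marginal q (insert v B) i * marginal q S i = marginal q (insert v S) i * marginal q B i := by
  classical
  -- `ρ` is the conditional probability of `v` given `B`. It ignores every coordinate in `B \ S`:
  -- after expanding the denominators over the value at `v`, the absence of interaction matches the
  -- sums term by term.
  set ρ : (∀ v, I v) → ℝ := fun i => marginal q (insert v B) i / marginal q B i with hρ
  have hinv : ∀ w ∈ B, w ∉ S → ∀ i a, ρ (Function.update i w a) = ρ i := by
    intro w hw hwS i a
    have hvw : v ≠ w := by rintro rfl; exact hv hw
    simp only [hρ]
    rw [div_eq_div_iff (marginal_pos hq _ _).ne' (marginal_pos hq _ _).ne',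
      marginal_eq_sum_insert q hv, marginal_eq_sum_insert q hv, Finset.mul_sum, Finset.mul_sum]
    refine Finset.sum_congr rfl fun m _ => ?_
    rw [Function.update_comm hvw.symm, hInt w hw hwS, mul_comm]
  -- Since `ρ` ignores these coordinates, it can be pulled out while they are summed away one at a
  -- time; `D = B \ S` gives the claim.
  have main : ∀ D : Finset V, D ⊆ B \ S → ∀ i,
      marginal q (insert v (B \ D)) i = ρ i * marginal q (B \ D) i := by
    intro D
    induction D using Finset.induction_on with
    | empty =>
      intro _ i
      simp [hρ, div_mul_cancel₀ _ (marginal_pos hq B i).ne']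
    | insert w D hw ih =>
      intro hD i
      have hwBS := hD (Finset.mem_insert_self _ _)
      rw [Finset.mem_sdiff] at hwBS
      have hvw : v ≠ w := by rintro rfl; exact hv hwBS.1
      have h1 : insert w (B \ insert w D) = B \ D := by grind
      have h2 : insert w (insert v (B \ insert w D)) = insert v (B \ D) := by grind
      rw [marginal_eq_sum_insert q (w := w) (B := insert v (B \ insert w D)) (by grind),
        marginal_eq_sum_insert q (w := w) (B := B \ insert w D) (by grind), h1, h2,
        Finset.mul_sum]
      refine Finset.sum_congr rfl fun a _ => ?_
      rw [ih ((Finset.subset_insert _ _).trans hD), hinv w hwBS.1 hwBS.2]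
  have := main (B \ S) subset_rfl i
  rw [Finset.sdiff_sdiff_eq_self hS] at this
  rw [this]
  simp only [hρ]
  field_simp [(marginal_pos hq B i).ne']

omit [DecidableEq V] in
lemma IsMoralDAG.exists_sink {G : SimpleGraph V} {pa : V → Finset V} (h : IsMoralDAG G pa)
    {A : Finset V} (hA : A.Nonempty) : ∃ v ∈ A, ∀ w ∈ A, v ∉ pa w := by
  let R : V → V → Prop := fun a b => Relation.TransGen (fun u w => u ∈ pa w) b a
  have : IsTrans V R := ⟨fun a b c hab hbc => hbc.trans hab⟩
  have : Std.Irrefl R := ⟨fun a ha => h.acyclic a ha⟩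
  have wf : WellFounded R := Finite.wellFounded_of_trans_of_irrefl R
  obtain ⟨v, hv, hmin⟩ := wf.has_min (A : Set V) hA
  exact ⟨v, hv, fun w hw hvw => hmin w hw (Relation.TransGen.single hvw)⟩

/-- Induction on an ancestral set `A`, splitting off a sink `v`, whose conditional probability given
the rest involves only its parents. The pairwise hypothesis survives for `A.erase v`: of two
non-adjacent vertices at most one is a parent of `v`, by morality, so the factor of `v` ignores one
of them and cancels. -/
lemma marginal_eq_prod_condParam {G : SimpleGraph V} {q : (∀ v, I v) → ℝ} (hq : ∀ i, 0 < q i)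
    (hsum : ∑ i, q i = 1) {pa : V → Finset V} (hpa : IsMoralDAG G pa) :
    ∀ A : Finset V, (∀ v ∈ A, pa v ⊆ A) →
      (∀ u ∈ A, ∀ w ∈ A, u ≠ w → ¬ G.Adj u w → NoInteraction (marginal q A) u w) →
      ∀ i, marginal q A i = ∏ v ∈ A, condParam q pa v (fun w => i w) (i v) := by
  intro A
  induction A using Finset.strongInduction with
  | H A ih =>
    intro hanc hInt i
    rcases A.eq_empty_or_nonempty with rfl | hne
    · rw [marginal_empty, hsum, Finset.prod_empty]
    obtain ⟨v, hvA, hsink⟩ := hpa.exists_sink hne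
    have hins : insert v (A.erase v) = A := Finset.insert_erase hvA
    have hv : v ∉ A.erase v := Finset.notMem_erase v A
    have hS : pa v ⊆ A.erase v := fun w hw =>
      Finset.mem_erase.2 ⟨fun h => hsink v hvA (h ▸ hw), hanc v hvA hw⟩
    have hfac : ∀ i, marginal q A i =
        condParam q pa v (fun w => i w) (i v) * marginal q (A.erase v) i := by
      intro i
      have := marginal_insert_mul hq hv hS (fun w hw hwS => by
        rw [hins]
        refine hInt v hvA w (Finset.mem_of_mem_erase hw) (Finset.ne_of_mem_erase hw).symm ?_
        rw [hpa.skeleton]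
        exact fun h => h.elim (hsink w (Finset.mem_of_mem_erase hw)) hwS) i
      rw [hins] at this
      rw [condParam_eq_marginal_div, div_mul_eq_mul_div, eq_div_iff (marginal_pos hq _ _).ne',
        this]
    have hcp : ∀ i : ∀ v, I v, 0 < condParam q pa v (fun w => i w) (i v) := fun i => by
      rw [condParam_eq_marginal_div]
      exact div_pos (marginal_pos hq _ _) (marginal_pos hq _ _)
    have hcpu : ∀ u, u ≠ v → u ∉ pa v → ∀ (i : ∀ v, I v) (a : I u),
        condParam q pa v (fun w => Function.update i u a w) (Function.update i u a v) =
          condParam q pa v (fun w => i w) (i v) := by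
      intro u huv hu i a
      rw [condParam_eq_marginal_div, condParam_eq_marginal_div, marginal_update_of_notMem q hu,
        marginal_update_of_notMem q (by simp [huv, hu])]
    have hInt' : ∀ u ∈ A.erase v, ∀ w ∈ A.erase v, u ≠ w → ¬ G.Adj u w → u ∉ pa v →
        NoInteraction (marginal q (A.erase v)) u w := by
      intro u hu w hw huw hadj hupa i a b
      have h := hInt u (Finset.mem_of_mem_erase hu) w (Finset.mem_of_mem_erase hw) huw hadj i a b
      rw [hfac, hfac, hfac, hfac, Function.update_comm huw,
        hcpu u (Finset.ne_of_mem_erase hu) hupa, hcpu u (Finset.ne_of_mem_erase hu) hupa,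
        ← Function.update_comm huw] at h
      refine mul_left_cancel₀ (mul_pos (hcp i) (hcp (Function.update i w b))).ne' ?_
      linear_combination h
    rw [hfac, ih _ (Finset.erase_ssubset hvA), ← Finset.mul_prod_erase A _ hvA]
    · intro w hw u hu
      refine Finset.mem_erase.2 ⟨?_, hanc w (Finset.mem_of_mem_erase hw) hu⟩
      rintro rfl
      exact hsink w (Finset.mem_of_mem_erase hw) hu
    · intro u hu w hw huw hadj
      by_cases hupa : u ∈ pa v
      · have hwpa : w ∉ pa v := fun hwpa => hadj (hpa.moral v u hupa w hwpa huw)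
        exact (hInt' w hw u hu huw.symm (fun h => hadj h.symm) hwpa).symm huw.symm
      · exact hInt' u hu w hw huw hadj hupa

/-- A positive table which is pairwise Markov factorizes along any moral DAG. -/
theorem IsMarkov.eq_prod_condParam {G : SimpleGraph V} {q : (∀ v, I v) → ℝ} (hq : ∀ i, 0 < q i)
    (hsum : ∑ i, q i = 1) (hG : IsMarkov G q) {pa : V → Finset V} (hpa : IsMoralDAG G pa)
    (i : ∀ v, I v) : q i = ∏ v, condParam q pa v (fun w => i w) (i v) := by
  rw [← marginal_univ q i]
  refine marginal_eq_prod_condParam hq hsum hpa Finset.univ (fun _ _ => Finset.subset_univ _)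
    (fun u _ w _ huw hadj => ?_) i
  rw [show marginal q Finset.univ = q from funext (marginal_univ q)]
  exact hG.noInteraction hq huw hadj

end Factorization

/-! ### Johnson's argument: affine predictive probabilities. -/

section Sufficientness

variable {ι : Type*} [Fintype ι] [DecidableEq ι]

/-- Induction on multi-indices by increasing one coordinate. -/
lemma multiIndex_induction {Q : (ι → ℕ) → Prop} (zero : Q 0)
    (step : ∀ r m, Q r → Q (r + Pi.single m 1)) (r : ι → ℕ) : Q r := by
  induction h : ∑ m, r m generalizing r with
  | zero =>
    have : r = 0 := funext fun m => by simpa using (Finset.sum_eq_zero_iff.1 h) m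
    exact this ▸ zero
  | succ n ih =>
    obtain ⟨m, -, hm⟩ : ∃ m ∈ Finset.univ, r m ≠ 0 :=
      Finset.exists_ne_zero_of_sum_ne_zero (by omega)
    have hr : r - Pi.single m 1 + Pi.single m 1 = r := by
      refine funext fun l => ?_
      by_cases hl : l = m
      · subst hl
        simp only [Pi.add_apply, Pi.sub_apply, Pi.single_eq_same]
        omega
      · simp [hl]
    rw [← hr]
    refine step _ _ (ih _ ?_)
    rw [← hr] at h
    simp only [Pi.add_apply, Finset.sum_add_distrib, Finset.sum_pi_single', Finset.mem_univ,
      if_true] at h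
    simpa using h

lemma sum_add_single (r : ι → ℕ) (m : ι) :
    ∑ l, (r + Pi.single m 1 : ι → ℕ) l = ∑ l, r l + 1 := by
  simp [Finset.sum_add_distrib]

/-- If the mixed multiplicative differences of a positive moment function only depend on the total
degree, then the predictive probabilities are affine (W. E. Johnson). -/
lemma exists_affine_predictive [Nontrivial ι] {M : (ι → ℕ) → ℝ} (hpos : ∀ r, 0 < M r)
    (hsum : ∀ r, ∑ m, M (r + Pi.single m 1) = M r) {H : ℕ → ℝ}
    (hH : ∀ r m m', m ≠ m' → M r * M (r + Pi.single m 1 + Pi.single m' 1) =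
      H (∑ l, r l) * (M (r + Pi.single m 1) * M (r + Pi.single m' 1))) :
    ∃ α : ι → ℝ, ∃ c : ℝ, (∀ m, 0 < α m) ∧ 0 ≤ c ∧
      ∀ r m, M (r + Pi.single m 1) * (∑ l, α l + c * (∑ l, r l : ℕ)) = M r * (α m + c * r m) := by
  obtain ⟨m₁, m₂, h12⟩ := exists_pair_ne ι
  have hHpos : ∀ n, 0 < H n := by
    intro n
    have h := hH (Pi.single m₁ n) m₁ m₂ h12
    rw [Finset.sum_pi_single'] at h
    simp only [Finset.mem_univ, if_true] at h
    have h1 := mul_pos (hpos (Pi.single m₁ n))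
      (hpos (Pi.single m₁ n + Pi.single m₁ 1 + Pi.single m₂ 1))
    rw [h] at h1
    exact pos_of_mul_pos_left h1 (mul_pos (hpos _) (hpos _)).le
  set φ : ℕ → ℝ := fun n => ∏ t ∈ Finset.range n, H t with hφ
  have hφpos : ∀ n, 0 < φ n := fun n => Finset.prod_pos fun t _ => hHpos t
  have hφs : ∀ n, φ (n + 1) = φ n * H n := fun n => Finset.prod_range_succ _ _
  -- Dividing the predictive probability by `φ` absorbs the factor `H`, so that `g m` is unchanged
  -- when a coordinate other than `m` increases.
  set g : ι → (ι → ℕ) → ℝ := fun m r => M (r + Pi.single m 1) / (M r * φ (∑ l, r l)) with hg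
  have hgpos : ∀ m r, 0 < g m r := fun m r => div_pos (hpos _) (mul_pos (hpos _) (hφpos _))
  have hgother : ∀ m m' r, m ≠ m' → g m (r + Pi.single m' 1) = g m r := by
    intro m m' r hne
    simp only [hg]
    rw [sum_add_single, hφs, div_eq_div_iff
      (mul_pos (hpos _) (mul_pos (hφpos _) (hHpos _))).ne' (mul_pos (hpos _) (hφpos _)).ne',
      add_right_comm]
    linear_combination φ (∑ l, r l) * hH r m m' hne
  have hgsum : ∀ r, ∑ m, g m r = (φ (∑ l, r l))⁻¹ := by
    intro r
    simp only [hg]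
    rw [← Finset.sum_div, hsum, div_mul_eq_div_div, div_self (hpos r).ne', one_div]
  have hgdiff : ∀ m r, g m (r + Pi.single m 1) - g m r =
      (φ (∑ l, r l + 1))⁻¹ - (φ (∑ l, r l))⁻¹ := by
    -- Only the summand `m` changes in the total of the `g l`, and this total is a function of the
    -- degree alone.
    intro m r
    rw [← hgsum r, ← sum_add_single r m, ← hgsum, ← Finset.sum_sub_distrib,
      Finset.sum_eq_single m]
    · intro l _ hl
      rw [hgother l m r hl, sub_self]
    · simp
  set c : ℝ := (φ 1)⁻¹ - (φ 0)⁻¹ with hc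
  have hconst : ∀ n, (φ (n + 1))⁻¹ - (φ n)⁻¹ = c := by
    intro n
    induction n with
    | zero => rfl
    | succ n ih =>
      rw [← ih]
      -- An extra observation of `m₂` raises the degree but leaves `g m₁` alone, so the increments
      -- at degrees `n` and `n + 1` coincide. This needs two distinct indices.
      have h1 := hgdiff m₁ (Pi.single m₁ n)
      have h2 := hgdiff m₁ (Pi.single m₁ n + Pi.single m₂ 1)
      rw [sum_add_single, add_right_comm, hgother _ _ _ h12, hgother _ _ _ h12, h1] at h2
      simpa [Finset.sum_pi_single'] using h2.symm
  have haff : ∀ m r, g m r = g m 0 + c * r m := by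
    intro m r
    induction r using multiIndex_induction with
    | zero => simp
    | step r m' ih =>
      by_cases h : m = m'
      · subst h
        have := hgdiff m r
        rw [hconst] at this
        simp only [Pi.add_apply, Pi.single_eq_same]
        push_cast
        linarith
      · rw [hgother _ _ _ h, ih]
        simp [h]
  refine ⟨fun m => g m 0, c, fun m => hgpos m 0, ?_, fun r m => ?_⟩
  -- A negative slope would make `g m₁` negative after enough observations of `m₁`.
  · by_contra! hneg
    obtain ⟨n, hn⟩ := exists_nat_gt (g m₁ 0 / (-c))
    rw [div_lt_iff₀ (by linarith)] at hn
    have := hgpos m₁ (Pi.single m₁ n)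
    rw [haff] at this
    simp only [Pi.single_eq_same] at this
    nlinarith
  · rw [← haff]
    have h1 : ∑ l, g l 0 + c * (∑ l, r l : ℕ) = (φ (∑ l, r l))⁻¹ := by
      rw [← hgsum]
      simp_rw [haff _ r]
      rw [Finset.sum_add_distrib, ← Finset.mul_sum]
      push_cast
      rfl
    rw [h1]
    simp only [hg]
    have := (hpos r).ne'
    field_simp

end Sufficientness

/-! ### The moment problem on the cube. -/

section Moments

variable {ι : Type*} [Fintype ι]

/-- A finite measure on the unit cube is determined by its moments. -/
theorem ext_of_moments_eq {ν ν' : Measure (ι → ℝ)} [IsFiniteMeasure ν] [IsFiniteMeasure ν']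
    (hν : ∀ᵐ x ∂ν, ∀ m, x m ∈ Set.Icc (0 : ℝ) 1) (hν' : ∀ᵐ x ∂ν', ∀ m, x m ∈ Set.Icc (0 : ℝ) 1)
    (h : ∀ r : ι → ℕ, ∫ x, ∏ m, x m ^ r m ∂ν = ∫ x, ∏ m, x m ^ r m ∂ν') : ν = ν' := by
  -- Clamping to the compact cube loses nothing, because the points outside the cube are null. There
  -- the polynomials in the coordinates form a point-separating algebra, and integrals over such an
  -- algebra determine a finite measure.
  let T : (ι → ℝ) → (ι → unitInterval) := fun x m => Set.projIcc 0 1 zero_le_one (x m)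
  let C : (ι → unitInterval) → (ι → ℝ) := fun y m => y m
  have hT : Continuous T := continuous_pi fun m => continuous_projIcc.comp (continuous_apply m)
  have hC : Continuous C := continuous_pi fun m => continuous_subtype_val.comp (continuous_apply m)
  have hCT : ∀ x : ι → ℝ, (∀ m, x m ∈ Set.Icc (0 : ℝ) 1) → C (T x) = x := fun x hx =>
    funext fun m => by simp [C, T, Set.projIcc_of_mem _ (hx m)]
  have hmap : ∀ ρ : Measure (ι → ℝ), (∀ᵐ x ∂ρ, ∀ m, x m ∈ Set.Icc (0 : ℝ) 1) →
      (ρ.map T).map C = ρ := by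
    intro ρ hρ
    rw [Measure.map_map hC.measurable hT.measurable]
    calc ρ.map (C ∘ T) = ρ.map id := Measure.map_congr (hρ.mono fun x hx => hCT x hx)
      _ = ρ := Measure.map_id
  rw [← hmap ν hν, ← hmap ν' hν']
  congr 1
  let X : ι → BoundedContinuousFunction (ι → unitInterval) ℝ := fun m =>
    BoundedContinuousFunction.mkOfCompact
      ⟨fun y => (y m : ℝ), continuous_subtype_val.comp (continuous_apply m)⟩
  let A : StarSubalgebra ℝ (BoundedContinuousFunction (ι → unitInterval) ℝ) :=
    { (MvPolynomial.aeval (R := ℝ) X).range with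
      star_mem' := fun {g} hg => by
        have : star g = g := by ext; simp
        rwa [this] }
  have hXA : ∀ m, X m ∈ A := fun m => ⟨MvPolynomial.X m, by simp⟩
  refine ext_of_forall_mem_subalgebra_integral_eq_of_polish (A := A) ?_ ?_
  · intro x y hxy
    obtain ⟨m, hm⟩ := Function.ne_iff.1 hxy
    exact ⟨X m, ⟨BoundedContinuousFunction.toContinuousMapStarₐ ℝ (X m), ⟨X m, hXA m, rfl⟩, rfl⟩,
      fun h => hm (Subtype.ext h)⟩
  · rintro g ⟨P, rfl⟩
    have hev : ∀ y, (MvPolynomial.aeval (R := ℝ) X P) y =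
        ∑ d ∈ P.support, P.coeff d * ∏ m, (y m : ℝ) ^ d m := by
      intro y
      rw [MvPolynomial.aeval_def, MvPolynomial.eval₂_eq', BoundedContinuousFunction.coe_sum,
        Finset.sum_apply]
      refine Finset.sum_congr rfl fun d _ => ?_
      rw [BoundedContinuousFunction.mul_apply, BoundedContinuousFunction.coe_prod,
        Finset.prod_apply]
      rfl
    have hInt : ∀ ρ : Measure (ι → ℝ), IsFiniteMeasure ρ →
        (∀ᵐ x ∂ρ, ∀ m, x m ∈ Set.Icc (0 : ℝ) 1) →
        ∫ y, (MvPolynomial.aeval (R := ℝ) X P) y ∂(ρ.map T) =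
          ∑ d ∈ P.support, P.coeff d * ∫ x, ∏ m, x m ^ d m ∂ρ := by
      intro ρ _ hρ
      simp_rw [hev]
      rw [integral_finsetSum]
      · refine Finset.sum_congr rfl fun d _ => ?_
        rw [integral_const_mul, integral_map hT.measurable.aemeasurable
          (by fun_prop : Continuous fun y : ι → unitInterval =>
            ∏ m, (y m : ℝ) ^ d m).aestronglyMeasurable]
        congr 1
        refine integral_congr_ae (hρ.mono fun x hx => ?_)
        refine Finset.prod_congr rfl fun m _ => ?_
        rw [show ((T x m : unitInterval) : ℝ) = x m from congrFun (hCT x hx) m]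
      · intro d _
        have hcont : Continuous fun y : ι → unitInterval =>
          P.coeff d * ∏ m, (y m : ℝ) ^ d m := by fun_prop
        exact (BoundedContinuousFunction.mkOfCompact ⟨_, hcont⟩).integrable _
    exact (hInt ν inferInstance hν).trans
      ((Finset.sum_congr rfl fun d _ => by rw [h]).trans (hInt ν' inferInstance hν').symm)

end Moments

/-! ### The multivariate Beta integral. -/

section DirichletIntegral

open Real

/-- The power function, extended by zero to the nonpositive numbers. -/
noncomputable def powPos (a t : ℝ) : ℝ := if 0 < t then t ^ (a - 1) else 0

lemma powPos_nonneg (a t : ℝ) : 0 ≤ powPos a t := by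
  unfold powPos
  split_ifs with h
  · positivity
  · rfl

@[fun_prop]
lemma measurable_powPos (a : ℝ) : Measurable (powPos a) :=
  Measurable.ite measurableSet_Ioi (by fun_prop) measurable_const

lemma powPos_mul {a s t : ℝ} (hs : 0 < s) : powPos a (s * t) = s ^ (a - 1) * powPos a t := by
  unfold powPos
  by_cases ht : 0 < t
  · rw [if_pos (mul_pos hs ht), if_pos ht, mul_rpow hs.le ht.le]
  · rw [if_neg (fun h => ht (pos_of_mul_pos_right h hs.le)), if_neg ht, mul_zero]

lemma exp_mul_powPos_eq_indicator (a : ℝ) : (fun t => exp (-t) * powPos a t) =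
    (Set.Ioi (0 : ℝ)).indicator fun t => exp (-t) * t ^ (a - 1) := by
  ext t
  simp [powPos, Set.indicator_apply]

lemma integrable_exp_mul_powPos {a : ℝ} (ha : 0 < a) :
    Integrable fun t => exp (-t) * powPos a t := by
  rw [exp_mul_powPos_eq_indicator, integrable_indicator_iff measurableSet_Ioi]
  exact Real.GammaIntegral_convergent ha

lemma integral_exp_mul_powPos {a : ℝ} (ha : 0 < a) :
    ∫ t, exp (-t) * powPos a t = Gamma a := by
  rw [exp_mul_powPos_eq_indicator, integral_indicator measurableSet_Ioi, Gamma_eq_integral ha]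

lemma lintegral_exp_mul_powPos {a : ℝ} (ha : 0 < a) :
    ∫⁻ t, ENNReal.ofReal (exp (-t) * powPos a t) = ENNReal.ofReal (Gamma a) := by
  rw [← ofReal_integral_eq_lintegral_ofReal (integrable_exp_mul_powPos ha)
    (.of_forall fun t => mul_nonneg (exp_pos _).le (powPos_nonneg _ _)),
    integral_exp_mul_powPos ha]

variable {κ : Type*} [Fintype κ]

/-- The Dirichlet integral over the simplex of size `s`. -/
noncomputable def simplexIntegral (a : ℝ) (α : κ → ℝ) (s : ℝ) : ENNReal :=
  ∫⁻ x : κ → ℝ, ENNReal.ofReal (powPos a (s - ∑ m, x m) * ∏ m, powPos (α m) (x m))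

lemma simplexIntegral_of_nonpos (a : ℝ) (α : κ → ℝ) {s : ℝ} (hs : s ≤ 0) :
    simplexIntegral a α s = 0 := by
  unfold simplexIntegral
  rw [lintegral_eq_zero_iff (by fun_prop)]
  refine .of_forall fun x => ?_
  simp only [Pi.zero_apply, ENNReal.ofReal_eq_zero]
  refine le_of_eq ?_
  by_cases h : ∀ m, 0 < x m
  · have : 0 ≤ ∑ m, x m := Finset.sum_nonneg fun m _ => (h m).le
    rw [powPos, if_neg (by linarith), zero_mul]
  · push Not at h
    obtain ⟨m, hm⟩ := h
    rw [Finset.prod_eq_zero (Finset.mem_univ m) (by rw [powPos, if_neg hm.not_gt]), mul_zero]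

/-- Substitution of `s • x` for `x`: the integrand is homogeneous, and Lebesgue measure supplies one
factor `s` per coordinate. -/
lemma simplexIntegral_eq_mul (a : ℝ) (α : κ → ℝ) {s : ℝ} (hs : 0 < s) :
    simplexIntegral a α s = ENNReal.ofReal (s ^ (a + ∑ m, α m - 1)) * simplexIntegral a α 1 := by
  have hmap := Measure.map_addHaar_smul (volume : Measure (κ → ℝ)) hs.ne'
  have h1 : ∫⁻ x : κ → ℝ, ENNReal.ofReal (powPos a (s - ∑ m, (s • x) m) *
      ∏ m, powPos (α m) ((s • x) m)) =
      ENNReal.ofReal |(s ^ Module.finrank ℝ (κ → ℝ))⁻¹| * simplexIntegral a α s := by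
    rw [simplexIntegral, ← smul_eq_mul, ← lintegral_smul_measure, ← hmap,
      lintegral_map (by fun_prop) (by fun_prop)]
  have h2 : ∀ x : κ → ℝ, ENNReal.ofReal (powPos a (s - ∑ m, (s • x) m) *
      ∏ m, powPos (α m) ((s • x) m)) = ENNReal.ofReal (s ^ (a - 1) * ∏ m, s ^ (α m - 1)) *
        ENNReal.ofReal (powPos a (1 - ∑ m, x m) * ∏ m, powPos (α m) (x m)) := by
    intro x
    rw [← ENNReal.ofReal_mul (by positivity)]
    congr 1
    have : s - ∑ m, (s • x) m = s * (1 - ∑ m, x m) := by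
      simp [mul_sub, Finset.mul_sum]
    rw [this, powPos_mul hs]
    simp_rw [Pi.smul_apply, smul_eq_mul, powPos_mul hs, Finset.prod_mul_distrib]
    ring
  simp_rw [h2] at h1
  rw [lintegral_const_mul _ (by fun_prop), ← simplexIntegral, Module.finrank_fintype_fun_eq_card,
    abs_of_pos (by positivity)] at h1
  have h3 : ENNReal.ofReal (s ^ Fintype.card κ) * ENNReal.ofReal ((s ^ Fintype.card κ)⁻¹) = 1 := by
    rw [← ENNReal.ofReal_mul (by positivity), mul_inv_cancel₀ (by positivity), ENNReal.ofReal_one]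
  rw [← one_mul (simplexIntegral a α s), ← h3, mul_assoc, ← h1, ← mul_assoc,
    ← ENNReal.ofReal_mul (by positivity)]
  congr 2
  rw [← rpow_sum_of_pos hs, ← rpow_add hs, ← rpow_natCast, ← rpow_add hs]
  congr 1
  simp [Finset.sum_sub_distrib]
  ring

/-- The multivariate Beta integral. -/
theorem simplexIntegral_one_mul_Gamma {a : ℝ} (ha : 0 < a) {α : κ → ℝ} (hα : ∀ m, 0 < α m) :
    simplexIntegral a α 1 * ENNReal.ofReal (Gamma (a + ∑ m, α m)) =
      ENNReal.ofReal (Gamma a * ∏ m, Gamma (α m)) := by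
  have hsum : 0 < a + ∑ m, α m :=
    add_pos_of_pos_of_nonneg ha (Finset.sum_nonneg fun m _ => (hα m).le)
  -- The integral of `exp (-s)` times the simplex integral of size `s` is computed twice: by
  -- homogeneity here, and below by Tonelli and the shift of `s` by `∑ m, x m`, which separates all
  -- the variables.
  have hL : ∫⁻ s, ENNReal.ofReal (exp (-s)) * simplexIntegral a α s =
      simplexIntegral a α 1 * ENNReal.ofReal (Gamma (a + ∑ m, α m)) := by
    rw [← lintegral_exp_mul_powPos hsum, ← lintegral_const_mul _ (by fun_prop)]
    refine lintegral_congr fun s => ?_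
    rcases le_or_gt s 0 with hs | hs
    · rw [simplexIntegral_of_nonpos _ _ hs, powPos, if_neg hs.not_gt]
      simp
    · rw [simplexIntegral_eq_mul _ _ hs, powPos, if_pos hs, ENNReal.ofReal_mul (exp_pos _).le]
      ring
  rw [← hL]
  unfold simplexIntegral
  have hprod : ∫⁻ x : κ → ℝ, ENNReal.ofReal (∏ m, (exp (-x m) * powPos (α m) (x m))) =
      ENNReal.ofReal (∏ m, Gamma (α m)) := by
    have hInt : Integrable fun x : κ → ℝ => ∏ m, (exp (-x m) * powPos (α m) (x m)) :=
      Integrable.fintype_prod fun m => integrable_exp_mul_powPos (hα m)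
    rw [← ofReal_integral_eq_lintegral_ofReal hInt
      (.of_forall fun x => Finset.prod_nonneg fun m _ =>
        mul_nonneg (exp_pos _).le (powPos_nonneg _ _)),
      integral_fintype_prod_volume_eq_prod (fun m t => exp (-t) * powPos (α m) t)]
    simp_rw [integral_exp_mul_powPos (hα _)]
  calc ∫⁻ s, ENNReal.ofReal (exp (-s)) *
        ∫⁻ x : κ → ℝ, ENNReal.ofReal (powPos a (s - ∑ m, x m) * ∏ m, powPos (α m) (x m))
      = ∫⁻ s, ∫⁻ x : κ → ℝ, ENNReal.ofReal (exp (-s) *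
          (powPos a (s - ∑ m, x m) * ∏ m, powPos (α m) (x m))) := by
        refine lintegral_congr fun s => ?_
        rw [← lintegral_const_mul _ (by fun_prop)]
        simp_rw [← ENNReal.ofReal_mul (exp_pos _).le]
    _ = ∫⁻ x : κ → ℝ, ∫⁻ s, ENNReal.ofReal (exp (-s) *
          (powPos a (s - ∑ m, x m) * ∏ m, powPos (α m) (x m))) := by
        refine lintegral_lintegral_swap (Measurable.aemeasurable ?_)
        unfold Function.uncurry
        fun_prop
    _ = ∫⁻ x : κ → ℝ, ENNReal.ofReal (Gamma a) *
          ENNReal.ofReal (∏ m, (exp (-x m) * powPos (α m) (x m))) := by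
        refine lintegral_congr fun x => ?_
        rw [← lintegral_exp_mul_powPos ha, ← lintegral_mul_const _ (by fun_prop),
          ← lintegral_add_right_eq_self _ (∑ m, x m)]
        refine lintegral_congr fun s => ?_
        rw [← ENNReal.ofReal_mul (mul_nonneg (exp_pos _).le (powPos_nonneg _ _)),
          add_sub_cancel_right, neg_add, exp_add, Finset.prod_mul_distrib, ← exp_sum,
          Finset.sum_neg_distrib]
        congr 1
        ring
    _ = _ := by
        rw [lintegral_const_mul _ (by fun_prop), hprod, ENNReal.ofReal_mul (Gamma_pos_of_pos ha).le]

end DirichletIntegral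

/-! ### Moments of the Dirichlet distribution and their recursion. -/

section DirichletMoments

variable {ι : Type*} [Fintype ι] [DecidableEq ι]

variable (ι) in
omit [DecidableEq ι] in
lemma measurableSet_simplex :
    MeasurableSet {y : ι → ℝ | (∀ m, 0 < y m) ∧ ∑ m, y m = 1} := by
  have : {y : ι → ℝ | (∀ m, 0 < y m) ∧ ∑ m, y m = 1} =
      (⋂ m, {y | 0 < y m}) ∩ {y | ∑ m, y m = 1} := by ext; simp
  rw [this]
  refine MeasurableSet.inter ?_ ?_
  · exact MeasurableSet.iInter fun m => measurableSet_lt measurable_const (measurable_pi_apply m)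
  · exact measurableSet_eq_fun (by fun_prop) measurable_const

@[fun_prop]
lemma measurable_complete (m₀ : ι) : Measurable (complete m₀) := by
  refine measurable_pi_lambda _ fun m => ?_
  unfold complete
  split_ifs
  · fun_prop
  · fun_prop

lemma sum_complete (m₀ : ι) (x : {m // m ≠ m₀} → ℝ) : ∑ m, complete m₀ x m = 1 := by
  rw [Fintype.sum_eq_add_sum_subtype_ne _ m₀]
  simp only [complete, dite_true]
  rw [Finset.sum_congr rfl fun (m : {m // m ≠ m₀}) _ => dif_neg m.2]
  simp

lemma prod_powPos_complete (α : ι → ℝ) (m₀ : ι) (x : {m // m ≠ m₀} → ℝ) :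
    ∏ m, powPos (α m) (complete m₀ x m) =
      powPos (α m₀) (1 - ∑ m, x m) * ∏ m : {m // m ≠ m₀}, powPos (α m) (x m) := by
  rw [Fintype.prod_eq_mul_prod_subtype_ne _ m₀]
  congr 1
  · simp [complete]
  · refine Finset.prod_congr rfl fun m _ => ?_
    simp [complete, m.2]

lemma dirichletDensity_eq_mul_prod_powPos (α : ι → ℝ) (m₀ : ι) (x : {m // m ≠ m₀} → ℝ) :
    dirichletDensity α m₀ x = Real.Gamma (∑ m, α m) / (∏ m, Real.Gamma (α m)) *
      ∏ m, powPos (α m) (complete m₀ x m) := by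
  unfold dirichletDensity
  split_ifs with h
  · congr 1
    exact Finset.prod_congr rfl fun m _ => (if_pos (h m)).symm
  · push Not at h
    obtain ⟨m, hm⟩ := h
    have : ∏ m, powPos (α m) (complete m₀ x m) = 0 :=
      Finset.prod_eq_zero (Finset.mem_univ m) (if_neg hm.not_gt)
    rw [this, mul_zero]

@[fun_prop]
lemma measurable_dirichletDensity (α : ι → ℝ) (m₀ : ι) : Measurable (dirichletDensity α m₀) := by
  rw [funext (dirichletDensity_eq_mul_prod_powPos α m₀)]
  simp_rw [prod_powPos_complete]
  fun_prop

lemma ae_dirichletMeasure (α : ι → ℝ) (m₀ : ι) :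
    ∀ᵐ y ∂dirichletMeasure α m₀, (∀ m, 0 < y m) ∧ ∑ m, y m = 1 := by
  rw [dirichletMeasure, ae_map_iff (by fun_prop) (measurableSet_simplex ι),
    ae_withDensity_iff (by fun_prop)]
  refine .of_forall fun x hx => ⟨?_, sum_complete m₀ x⟩
  by_contra h
  exact hx (by rw [dirichletDensity, if_neg h, ENNReal.ofReal_zero])

/-- A monomial with exponents `r` times the density is an unnormalized Dirichlet density with
parameters `α + r`, so the Beta integral applies again. -/
lemma lintegral_dirichletMeasure {α : ι → ℝ} (hα : ∀ m, 0 < α m) (m₀ : ι) (r : ι → ℕ) :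
    ∫⁻ y, ENNReal.ofReal (∏ m, y m ^ r m) ∂dirichletMeasure α m₀ =
      ENNReal.ofReal (Real.Gamma (∑ m, α m) / (∏ m, Real.Gamma (α m)) *
        ((∏ m, Real.Gamma (α m + r m)) / Real.Gamma (∑ m, (α m + r m)))) := by
  have hne : Nonempty ι := ⟨m₀⟩
  have hα' : ∀ m, 0 < α m + r m := fun m => add_pos_of_pos_of_nonneg (hα m) (Nat.cast_nonneg _)
  have hΓ : 0 < Real.Gamma (∑ m, α m) :=
    Real.Gamma_pos_of_pos (Finset.sum_pos (fun m _ => hα m) Finset.univ_nonempty)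
  have hΓ' : 0 < Real.Gamma (∑ m, (α m + r m)) :=
    Real.Gamma_pos_of_pos (Finset.sum_pos (fun m _ => hα' m) Finset.univ_nonempty)
  have hΓp : 0 < ∏ m, Real.Gamma (α m) := Finset.prod_pos fun m _ => Real.Gamma_pos_of_pos (hα m)
  have hC : 0 ≤ Real.Gamma (∑ m, α m) / (∏ m, Real.Gamma (α m)) := (div_pos hΓ hΓp).le
  have hF := simplexIntegral_one_mul_Gamma (hα' m₀) (α := fun m : {m // m ≠ m₀} => α m + r m)
    (fun m => hα' m)
  rw [← Fintype.sum_eq_add_sum_subtype_ne (fun m => α m + (r m : ℝ)) m₀,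
    ← Fintype.prod_eq_mul_prod_subtype_ne (fun m => Real.Gamma (α m + (r m : ℝ))) m₀] at hF
  have hF' : simplexIntegral (α m₀ + r m₀) (fun m : {m // m ≠ m₀} => α m + r m) 1 =
      ENNReal.ofReal ((∏ m, Real.Gamma (α m + r m)) / Real.Gamma (∑ m, (α m + r m))) := by
    rw [ENNReal.ofReal_div_of_pos hΓ', ENNReal.eq_div_iff (by simpa using hΓ')
      ENNReal.ofReal_ne_top, mul_comm, hF]
  rw [dirichletMeasure, lintegral_map (by fun_prop) (by fun_prop),
    lintegral_withDensity_eq_lintegral_mul _ (by fun_prop) (by fun_prop), ENNReal.ofReal_mul hC,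
    ← hF', simplexIntegral, ← lintegral_const_mul _ (by fun_prop)]
  refine lintegral_congr fun x => ?_
  rw [Pi.mul_apply, dirichletDensity_eq_mul_prod_powPos, ← ENNReal.ofReal_mul
    (mul_nonneg hC (Finset.prod_nonneg fun m _ => powPos_nonneg _ _)), ← ENNReal.ofReal_mul hC,
    ← prod_powPos_complete (fun m => α m + r m), mul_assoc, ← Finset.prod_mul_distrib]
  congr 2
  refine Finset.prod_congr rfl fun m _ => ?_
  unfold powPos
  split_ifs with h
  · rw [← Real.rpow_natCast, ← Real.rpow_add h]
    congr 1
    ring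
  · rw [zero_mul]

lemma isProbabilityMeasure_dirichletMeasure {α : ι → ℝ} (hα : ∀ m, 0 < α m) (m₀ : ι) :
    IsProbabilityMeasure (dirichletMeasure α m₀) := by
  have hne : Nonempty ι := ⟨m₀⟩
  have h := lintegral_dirichletMeasure hα m₀ 0
  have hΓ : 0 < Real.Gamma (∑ m, α m) :=
    Real.Gamma_pos_of_pos (Finset.sum_pos (fun m _ => hα m) Finset.univ_nonempty)
  have hΓp : 0 < ∏ m, Real.Gamma (α m) := Finset.prod_pos fun m _ => Real.Gamma_pos_of_pos (hα m)
  simp only [Pi.zero_apply, pow_zero, Finset.prod_const_one, ENNReal.ofReal_one, lintegral_one,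
    Nat.cast_zero, add_zero] at h
  rw [div_mul_div_cancel₀ hΓp.ne', div_self hΓ.ne', ENNReal.ofReal_one] at h
  exact ⟨h⟩

lemma integral_dirichletMeasure {α : ι → ℝ} (hα : ∀ m, 0 < α m) (m₀ : ι) (r : ι → ℕ) :
    ∫ y, ∏ m, y m ^ r m ∂dirichletMeasure α m₀ =
      Real.Gamma (∑ m, α m) / (∏ m, Real.Gamma (α m)) *
        ((∏ m, Real.Gamma (α m + r m)) / Real.Gamma (∑ m, (α m + r m))) := by
  rw [integral_eq_lintegral_of_nonneg_ae, lintegral_dirichletMeasure hα m₀ r,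
    ENNReal.toReal_ofReal]
  · refine mul_nonneg (div_nonneg ?_ ?_) (div_nonneg ?_ ?_)
    · exact Real.Gamma_nonneg_of_nonneg (Finset.sum_nonneg fun m _ => (hα m).le)
    · exact Finset.prod_nonneg fun m _ => Real.Gamma_nonneg_of_nonneg (hα m).le
    · exact Finset.prod_nonneg fun m _ => Real.Gamma_nonneg_of_nonneg
        (add_nonneg (hα m).le (Nat.cast_nonneg _))
    · exact Real.Gamma_nonneg_of_nonneg (Finset.sum_nonneg fun m _ =>
        add_nonneg (hα m).le (Nat.cast_nonneg _))
  · filter_upwards [ae_dirichletMeasure α m₀] with y hy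
    exact Finset.prod_nonneg fun m _ => pow_nonneg (hy.1 m).le _
  · exact (by fun_prop : Measurable fun y : ι → ℝ => ∏ m, y m ^ r m).aestronglyMeasurable

lemma integral_dirichletMeasure_add_single {α : ι → ℝ} (hα : ∀ m, 0 < α m) (m₀ : ι) (r : ι → ℕ)
    (m : ι) :
    (∫ y, ∏ l, y l ^ (r + Pi.single m 1 : ι → ℕ) l ∂dirichletMeasure α m₀) *
        (∑ l, α l + (∑ l, r l : ℕ)) =
      (∫ y, ∏ l, y l ^ r l ∂dirichletMeasure α m₀) * (α m + r m) := by
  have hne : Nonempty ι := ⟨m₀⟩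
  have hα' : ∀ m, 0 < α m + r m := fun m => add_pos_of_pos_of_nonneg (hα m) (Nat.cast_nonneg _)
  have hs : 0 < ∑ m, (α m + r m) := Finset.sum_pos (fun m _ => hα' m) Finset.univ_nonempty
  have h1 : ∑ l, (α l + ((r + Pi.single m 1 : ι → ℕ) l : ℕ)) = ∑ l, (α l + r l) + 1 := by
    rw [Finset.sum_add_distrib, ← Nat.cast_sum, sum_add_single, Finset.sum_add_distrib]
    push_cast
    ring
  have h2 : ∏ l, Real.Gamma (α l + ((r + Pi.single m 1 : ι → ℕ) l : ℕ)) =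
      (α m + r m) * ∏ l, Real.Gamma (α l + r l) := by
    rw [← Finset.mul_prod_erase _ _ (Finset.mem_univ m),
      ← Finset.mul_prod_erase _ (fun l => Real.Gamma (α l + r l)) (Finset.mem_univ m), ← mul_assoc,
      ← Real.Gamma_add_one (hα' m).ne']
    congr 1
    · simp [add_assoc]
    · refine Finset.prod_congr rfl fun l hl => ?_
      simp [Finset.ne_of_mem_erase hl]
  rw [integral_dirichletMeasure hα, integral_dirichletMeasure hα, h1, h2,
    Real.Gamma_add_one hs.ne', Nat.cast_sum, ← Finset.sum_add_distrib]
  have := (Real.Gamma_pos_of_pos hs).ne'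
  field_simp

/-- A probability measure on the simplex whose predictive probabilities are those of a Dirichlet
distribution is this Dirichlet distribution. -/
theorem eq_dirichletMeasure {ν : Measure (ι → ℝ)} [IsProbabilityMeasure ν]
    (hν : ∀ᵐ y ∂ν, (∀ m, 0 < y m) ∧ ∑ m, y m = 1) {α : ι → ℝ} (hα : ∀ m, 0 < α m)
    (h : ∀ (r : ι → ℕ) m, (∫ y, ∏ l, y l ^ (r + Pi.single m 1 : ι → ℕ) l ∂ν) *
      (∑ l, α l + (∑ l, r l : ℕ)) = (∫ y, ∏ l, y l ^ r l ∂ν) * (α m + r m)) (m₀ : ι) :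
    ν = dirichletMeasure α m₀ := by
  have hne : Nonempty ι := ⟨m₀⟩
  have := isProbabilityMeasure_dirichletMeasure hα m₀
  have hcube : ∀ y : ι → ℝ, ((∀ m, 0 < y m) ∧ ∑ m, y m = 1) → ∀ m, y m ∈ Set.Icc (0 : ℝ) 1 :=
    fun y hy m => ⟨(hy.1 m).le,
      hy.2 ▸ Finset.single_le_sum (fun l _ => (hy.1 l).le) (Finset.mem_univ m)⟩
  refine ext_of_moments_eq (hν.mono hcube) ((ae_dirichletMeasure α m₀).mono hcube) fun r => ?_
  induction r using multiIndex_induction with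
  | zero => simp
  | step r m ih =>
    have hs : 0 < ∑ l, α l + (∑ l, r l : ℕ) :=
      add_pos_of_pos_of_nonneg (Finset.sum_pos (fun m _ => hα m) Finset.univ_nonempty)
        (Nat.cast_nonneg _)
    refine mul_right_cancel₀ hs.ne' ?_
    rw [h, integral_dirichletMeasure_add_single hα, ih]

end DirichletMoments

/-! ### Cross ratios of functions on a commutative monoid. -/

/-- The mixed multiplicative difference of `f` at `r` in the directions `a` and `b`. -/
noncomputable def crossRatio {A : Type*} [AddCommMonoid A] (f : A → ℝ) (r a b : A) : ℝ :=
  f r * f (r + a + b) / (f (r + a) * f (r + b))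

section CrossRatio

variable {A : Type*} [AddCommMonoid A]

lemma crossRatio_pos {f : A → ℝ} (hf : ∀ r, 0 < f r) (r a b : A) : 0 < crossRatio f r a b :=
  div_pos (mul_pos (hf _) (hf _)) (mul_pos (hf _) (hf _))

lemma crossRatio_zero_left {f : A → ℝ} (hf : ∀ r, 0 < f r) (r b : A) : crossRatio f r 0 b = 1 := by
  unfold crossRatio
  rw [add_zero]
  exact div_self (mul_pos (hf _) (hf _)).ne'

lemma crossRatio_zero_right {f : A → ℝ} (hf : ∀ r, 0 < f r) (r a : A) :
    crossRatio f r a 0 = 1 := by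
  unfold crossRatio
  rw [add_zero, add_zero, mul_comm]
  exact div_self (mul_pos (hf _) (hf _)).ne'

lemma crossRatio_prod {X : Type*} [Fintype X] {B : X → Type*} [∀ x, AddCommMonoid (B x)]
    (f : ∀ x, B x → ℝ) (T : ∀ x, A →+ B x) (r a b : A) :
    crossRatio (fun r => ∏ x, f x (T x r)) r a b =
      ∏ x, crossRatio (f x) (T x r) (T x a) (T x b) := by
  simp only [crossRatio, map_add, Finset.prod_mul_distrib, Finset.prod_div_distrib]

end CrossRatio

/-! ### From cross ratios of moments to the Dirichlet distribution. -/

section SimplexLaw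

variable {ι : Type*} [Fintype ι]

lemma measurable_monomial (r : ι → ℕ) : Measurable fun y : ι → ℝ => ∏ m, y m ^ r m := by
  fun_prop

lemma prod_pow_add_single [DecidableEq ι] (y : ι → ℝ) (r : ι → ℕ) (m : ι) :
    ∏ l, y l ^ (r + Pi.single m 1 : ι → ℕ) l = y m * ∏ l, y l ^ r l := by
  simp only [Pi.add_apply, pow_add, Finset.prod_mul_distrib]
  rw [mul_comm]
  congr 1
  rw [Finset.prod_eq_single m (fun l _ hl => by simp [hl]) (by simp)]
  simp

/-- The moments of a measure on `ι → ℝ`. -/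
noncomputable def moment (ν : Measure (ι → ℝ)) (r : ι → ℕ) : ℝ := ∫ y, ∏ m, y m ^ r m ∂ν

variable {ν : Measure (ι → ℝ)} [IsProbabilityMeasure ν]
  (hν : ∀ᵐ y ∂ν, (∀ m, 0 < y m) ∧ ∑ m, y m = 1)
include hν

lemma integrable_monomial (r : ι → ℕ) : Integrable (fun y : ι → ℝ => ∏ m, y m ^ r m) ν := by
  refine Integrable.of_bound
    (measurable_monomial r).aestronglyMeasurable 1 ?_
  filter_upwards [hν] with y hy
  have h0 : ∀ m, 0 ≤ y m := fun m => (hy.1 m).le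
  have h1 : ∀ m, y m ≤ 1 := fun m =>
    hy.2 ▸ Finset.single_le_sum (fun l _ => h0 l) (Finset.mem_univ m)
  rw [Real.norm_of_nonneg (Finset.prod_nonneg fun m _ => pow_nonneg (h0 m) _)]
  exact Finset.prod_le_one (fun m _ => pow_nonneg (h0 m) _) fun m _ => pow_le_one₀ (h0 m) (h1 m)

lemma moment_pos (r : ι → ℕ) : 0 < moment ν r := by
  have hpos : ∀ᵐ y ∂ν, 0 < ∏ m, y m ^ r m :=
    hν.mono fun y hy => Finset.prod_pos fun m _ => pow_pos (hy.1 m) _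
  unfold moment
  rw [integral_pos_iff_support_of_nonneg_ae (hpos.mono fun y hy => hy.le)
    (integrable_monomial hν r)]
  have : ν (Function.support fun y : ι → ℝ => ∏ m, y m ^ r m) = 1 := by
    rw [← measure_univ (μ := ν)]
    exact measure_congr (Filter.eventuallyEq_univ.2 (hpos.mono fun y hy => hy.ne'))
  rw [this]
  exact one_pos

lemma sum_moment_add_single [DecidableEq ι] (r : ι → ℕ) :
    ∑ m, moment ν (r + Pi.single m 1) = moment ν r := by
  unfold moment
  rw [← integral_finsetSum _ fun m _ => integrable_monomial hν _]
  refine integral_congr_ae (hν.mono fun y hy => ?_)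
  simp only [prod_pow_add_single]
  rw [← Finset.sum_mul, hy.2, one_mul]

-- With a single index the simplex is one point, so a law on it is degenerate.
omit [IsProbabilityMeasure ν] in
lemma nontrivial_of_nondegenerate (hnd : ¬ ∃ c, ∀ᵐ y ∂ν, y = c) : Nontrivial ι := by
  by_contra h
  rw [not_nontrivial_iff_subsingleton] at h
  refine hnd ⟨fun _ => 1, hν.mono fun y hy => funext fun m => ?_⟩
  rw [← hy.2, Finset.sum_eq_single m (fun l _ hl => absurd (Subsingleton.elim l m) hl) (by simp)]

/-- A non-degenerate random probability vector for which the cross ratios of the moments only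
depend on the total degree has a Dirichlet distribution. -/
theorem isDirichlet_of_crossRatio [DecidableEq ι] (hnd : ¬ ∃ c, ∀ᵐ y ∂ν, y = c) {H : ℕ → ℝ}
    (hH : ∀ (r : ι → ℕ) m m', m ≠ m' →
      crossRatio (moment ν) r (Pi.single m 1) (Pi.single m' 1) = H (∑ l, r l)) :
    IsDirichlet ν := by
  have := nontrivial_of_nondegenerate hν hnd
  have hpos := moment_pos hν
  obtain ⟨α, c, hα, hc, h⟩ := exists_affine_predictive hpos (sum_moment_add_single hν)
    (H := H) (fun r m m' hm => by
      rw [← hH r m m' hm, crossRatio, div_mul_cancel₀ _ (mul_pos (hpos _) (hpos _)).ne'])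
  have hsum : 0 < ∑ l, α l := Finset.sum_pos (fun m _ => hα m) Finset.univ_nonempty
  have h0 : moment ν 0 = 1 := by simp [moment]
  rcases hc.eq_or_lt with rfl | hc
  -- For `c = 0` the predictive probabilities ignore the counts. Then the second moment of each
  -- coordinate is the square of its mean, so its variance vanishes and the vector is almost surely
  -- constant.
  · exfalso
    refine hnd ⟨fun m => moment ν (Pi.single m 1), ?_⟩
    have hcoord : ∀ m, ∀ᵐ y ∂ν, y m = moment ν (Pi.single m 1) := by
      intro m
      set a := moment ν (Pi.single m 1) with ha
      have e1 := h 0 m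
      have e2 := h (Pi.single m 1) m
      rw [zero_add, h0, zero_mul, zero_mul, add_zero, add_zero, one_mul, ← ha] at e1
      rw [zero_mul, zero_mul, add_zero, add_zero, ← ha, ← e1] at e2
      have e3 : moment ν (Pi.single m 1 + Pi.single m 1) = a * a :=
        mul_right_cancel₀ hsum.ne' (by linear_combination e2)
      have i1 := integrable_monomial hν (Pi.single m 1)
      have i2 := integrable_monomial hν (Pi.single m 1 + Pi.single m 1)
      have m1 : ∀ y : ι → ℝ, ∏ l, y l ^ (Pi.single m 1 : ι → ℕ) l = y m := fun y => by
        simpa using prod_pow_add_single y 0 m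
      simp only [moment] at e3 ha
      simp only [prod_pow_add_single, m1] at e3 ha i1 i2
      have i3 : Integrable (fun y : ι → ℝ => y m * y m - 2 * a * y m) ν :=
        i2.sub (i1.const_mul _)
      have hsq : ∀ y : ι → ℝ, (y m - a) ^ 2 = y m * y m - 2 * a * y m + a ^ 2 := fun y => by ring
      have hInt : ∫ y, (y m - a) ^ 2 ∂ν = 0 := by
        simp_rw [hsq]
        rw [integral_add i3 (integrable_const _), integral_sub i2 (i1.const_mul _),
          integral_const_mul, e3, ← ha, integral_const, probReal_univ, one_smul]
        ring
      rw [integral_eq_zero_iff_of_nonneg (fun y => sq_nonneg _)] at hInt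
      · filter_upwards [hInt] with y hy
        exact sub_eq_zero.1 (pow_eq_zero_iff two_ne_zero |>.1 hy)
      · simp_rw [hsq]
        exact i3.add (integrable_const _)
    exact (ae_all_iff.2 hcoord).mono fun y hy => funext hy
  -- Dividing the affine relation by `c` normalizes the slope to 1, which is the Dirichlet recursion
  -- with parameters `α m / c`.
  · refine ⟨inferInstance, fun m => α m / c, fun m => div_pos (hα m) hc, fun m₀ => ?_⟩
    refine eq_dirichletMeasure hν (fun m => div_pos (hα m) hc) (fun r m => ?_) m₀
    have := h r m
    unfold moment at this
    rw [← Finset.sum_div]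
    field_simp
    linear_combination this

end SimplexLaw

/-! ### Cell counts seen from the vertices of a DAG. -/

section Counts

variable {V : Type*} [Fintype V] [DecidableEq V] {I : V → Type*} [∀ v, Fintype (I v)]
  [∀ v, DecidableEq (I v)]

/-- The numbers of observations with parent configuration `k` at the vertex `v`, sorted by the
value at `v`. -/
def parentCount (pa : V → Finset V) (v : V) (k : ∀ w : pa v, I w) :
    ((∀ v, I v) → ℕ) →+ (I v → ℕ) where
  toFun n m := ∑ i, if (fun w : pa v => i w) = k ∧ i v = m then n i else 0
  map_zero' := by ext; simp
  map_add' n n' := by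
    ext m
    rw [Pi.add_apply, ← Finset.sum_add_distrib]
    refine Finset.sum_congr rfl fun i _ => ?_
    split_ifs <;> simp

lemma parentCount_apply (pa : V → Finset V) (v : V) (k : ∀ w : pa v, I w) (n : (∀ v, I v) → ℕ)
    (m : I v) : parentCount pa v k n m =
      ∑ i, if (fun w : pa v => i w) = k ∧ i v = m then n i else 0 := rfl

lemma parentCount_single (pa : V → Finset V) (v : V) (k : ∀ w : pa v, I w) (i : ∀ v, I v) :
    parentCount pa v k (Pi.single i 1) =
      if (fun w : pa v => i w) = k then Pi.single (i v) 1 else 0 := by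
  ext m
  rw [parentCount_apply, Finset.sum_eq_single i (fun j _ hj => by simp [hj]) (by simp)]
  by_cases hk : (fun w : pa v => i w) = k
  · simp [hk, Pi.single_apply, eq_comm]
  · simp [hk]

/-- `r m` observations in the cell obtained from `x` by changing the value at `v` into `m`. -/
def sliceCount (x : ∀ v, I v) (v : V) (r : I v → ℕ) : (∀ v, I v) → ℕ :=
  ∑ m, r m • Pi.single (Function.update x v m) 1

omit [Fintype V] [∀ v, Fintype (I v)] [∀ v, DecidableEq (I v)] in
lemma restrict_update {pa : V → Finset V} {v w : V} (hv : v ∉ pa w) (x : ∀ v, I v) (m : I v) :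
    (fun u : pa w => Function.update x v m u) = fun u : pa w => x u :=
  funext fun u => by
    have : (u : V) ≠ v := fun h => hv (by rw [← h]; exact u.2)
    rw [Function.update_of_ne this]

/-- All cells of the slice agree with `x` away from `v`, hence at `w` and at its parents. This is
why such a vertex sees `r` only through its total. -/
lemma parentCount_sliceCount_of_ne {pa : V → Finset V} {v w : V} (hv : v ∉ pa w) (hwv : w ≠ v)
    (x : ∀ v, I v) (r : I v → ℕ) :
    parentCount pa w (fun u => x u) (sliceCount x v r) = Pi.single (x w) (∑ m, r m) := by
  simp only [sliceCount, map_sum, map_nsmul, parentCount_single, restrict_update hv, if_true,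
    Function.update_of_ne hwv]
  rw [← Finset.sum_smul, ← Pi.single_smul]
  simp

lemma parentCount_sliceCount_self {pa : V → Finset V} {v : V} (hv : v ∉ pa v)
    (x : ∀ v, I v) (r : I v → ℕ) :
    parentCount pa v (fun u => x u) (sliceCount x v r) = r := by
  simp only [sliceCount, map_sum, map_nsmul, parentCount_single, restrict_update hv, if_true,
    Function.update_self]
  ext m
  simp [Finset.sum_apply, Pi.single_apply]

/-- The cross ratio of a product of functions of the parent counts. -/
lemma crossRatio_prod_parentCount (pa : V → Finset V)
    {f : (x : Σ v, ∀ w : pa v, I w) → (I x.1 → ℕ) → ℝ} (hf : ∀ x r, 0 < f x r)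
    (n : (∀ v, I v) → ℕ) (i j : ∀ v, I v) :
    crossRatio (fun n => ∏ x : Σ v, ∀ w : pa v, I w, f x (parentCount pa x.1 x.2 n)) n
      (Pi.single i 1) (Pi.single j 1) =
    ∏ v, if (fun w : pa v => i w) = (fun w : pa v => j w) then
      crossRatio (f ⟨v, fun w => i w⟩) (parentCount pa v (fun w => i w) n)
        (Pi.single (i v) 1) (Pi.single (j v) 1) else 1 := by
  rw [crossRatio_prod f (fun x => parentCount pa x.1 x.2), Fintype.prod_sigma]
  refine Finset.prod_congr rfl fun v _ => ?_
  rw [Finset.prod_eq_single (fun w : pa v => i w)]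
  · simp only [parentCount_single, if_true]
    by_cases h : (fun w : pa v => i w) = (fun w : pa v => j w)
    · rw [if_pos h, if_pos h.symm]
    · rw [if_neg h, if_neg (Ne.symm h), crossRatio_zero_right (hf _)]
  · intro k _ hk
    simp only [parentCount_single]
    rw [if_neg hk.symm, crossRatio_zero_left (hf _)]
  · simp

/-- For a vertex `v`, cells `x` and `y`, the cross ratio at `sliceCount x v r` splits into the
contribution of `v` and a function of the total count. -/
lemma exists_crossRatio_sliceCount {pa : V → Finset V} (hpa : ∀ v, v ∉ pa v)
    {f : (x : Σ v, ∀ w : pa v, I w) → (I x.1 → ℕ) → ℝ} (hf : ∀ x r, 0 < f x r)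
    (v : V) (x y : ∀ v, I v) :
    ∃ C : ℕ → ℝ, (∀ N, 0 < C N) ∧ ∀ (r : I v → ℕ) (m m' : I v), m ≠ m' →
      crossRatio (fun n => ∏ x : Σ v, ∀ w : pa v, I w, f x (parentCount pa x.1 x.2 n))
        (sliceCount x v r) (Pi.single (Function.update x v m) 1)
        (Pi.single (Function.update y v m') 1) =
      (if ∀ w ∈ pa v, x w = y w then
        crossRatio (f ⟨v, fun w => x w⟩) r (Pi.single m 1) (Pi.single m' 1) else 1) *
        C (∑ l, r l) := by
  classical
  -- The constant collects the vertices other than `v`. A child of `v` contributes 1 because `m ≠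
  -- m'` makes its two parent configurations differ; any other vertex has all `N` observations at
  -- the value `x w`.
  refine ⟨fun N => ∏ w ∈ Finset.univ.erase v, if v ∉ pa w ∧ ∀ u ∈ pa w, x u = y u then
    crossRatio (f ⟨w, fun u => x u⟩) (Pi.single (x w) N) (Pi.single (x w) 1)
      (Pi.single (y w) 1) else 1, fun N => Finset.prod_pos fun w _ => ?_, fun r m m' hm => ?_⟩
  · split_ifs
    · exact crossRatio_pos (hf _) _ _ _
    · exact one_pos
  · rw [crossRatio_prod_parentCount pa hf, ← Finset.mul_prod_erase _ _ (Finset.mem_univ v)]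
    congr 1
    · rw [restrict_update (hpa v), restrict_update (hpa v),
        parentCount_sliceCount_self (hpa v), Function.update_self, Function.update_self]
      refine if_congr ?_ rfl rfl
      rw [funext_iff]
      exact Subtype.forall
    · refine Finset.prod_congr rfl fun w hw => ?_
      have hwv := Finset.ne_of_mem_erase hw
      by_cases hv : v ∈ pa w
      · rw [if_neg, if_neg (fun h => h.1 hv)]
        intro h
        have := congrFun h ⟨v, hv⟩
        simp only [Function.update_self] at this
        exact hm this
      · rw [restrict_update hv, restrict_update hv, parentCount_sliceCount_of_ne hv hwv,
          Function.update_of_ne hwv, Function.update_of_ne hwv]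
        refine if_congr ?_ rfl rfl
        rw [funext_iff, and_iff_right hv]
        exact Subtype.forall

end Counts

/-! ### Conditional probabilities as measurable points of the simplex. -/

section CondParam

variable {V : Type*} [Fintype V] [DecidableEq V] {I : V → Type*} [∀ v, Fintype (I v)]

omit [Fintype V] [∀ v, Fintype (I v)] in
lemma exists_cell [Nonempty (∀ v, I v)] {pa : V → Finset V} {v : V} (hv : v ∉ pa v)
    (k : ∀ w : pa v, I w) (m : I v) :
    ∃ i : ∀ v, I v, (fun w : pa v => i w) = k ∧ i v = m := by
  obtain ⟨i₀⟩ := ‹Nonempty (∀ v, I v)›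
  refine ⟨Function.update (fun w => if h : w ∈ pa v then k ⟨w, h⟩ else i₀ w) v m, ?_, by simp⟩
  rw [restrict_update hv]
  funext w
  simp

lemma condParam_mem_simplex [Nonempty (∀ v, I v)] {q : (∀ v, I v) → ℝ} (hq : ∀ i, 0 < q i)
    {pa : V → Finset V} {v : V} (hv : v ∉ pa v) (k : ∀ w : pa v, I w) :
    (∀ m, 0 < condParam q pa v k m) ∧ ∑ m, condParam q pa v k m = 1 := by
  constructor
  · intro m
    obtain ⟨i, rfl, rfl⟩ := exists_cell hv k m
    rw [condParam_eq_marginal_div]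
    exact div_pos (marginal_pos hq _ _) (marginal_pos hq _ _)
  · obtain ⟨i, rfl, -⟩ := exists_cell hv k (Classical.arbitrary (∀ v, I v) v)
    have : ∀ m, condParam q pa v (fun w => i w) m =
        marginal q (insert v (pa v)) (Function.update i v m) / marginal q (pa v) i := by
      intro m
      have := condParam_eq_marginal_div q pa v (Function.update i v m)
      rwa [restrict_update hv, Function.update_self, marginal_update_of_notMem q hv] at this
    simp_rw [this]
    rw [← Finset.sum_div, ← marginal_eq_sum_insert q hv, div_self (marginal_pos hq _ _).ne']

lemma measurable_condParam (pa : V → Finset V) (v : V) (k : ∀ w : pa v, I w) :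
    Measurable fun q : (∀ v, I v) → ℝ => condParam q pa v k := by
  classical
  have hprob : ∀ A : Set (∀ v, I v), Measurable fun q => prob q A := by
    intro A
    refine Finset.measurable_sum _ fun i _ => ?_
    simp only [Set.indicator_apply]
    split_ifs
    · exact measurable_pi_apply i
    · exact measurable_const
  exact measurable_pi_lambda _ fun m => (hprob _).div (hprob _)

end CondParam

/-! ### Comparison of two DAGs and conclusion. -/

section Main

variable {V : Type*} [Fintype V] [DecidableEq V] {I : V → Type*} [∀ v, Fintype (I v)]
  {Ω : Type*} [MeasurableSpace Ω] {μ : Measure Ω} [IsProbabilityMeasure μ]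
  {G : SimpleGraph V} {p : Ω → (∀ v, I v) → ℝ} {pa pa' : V → Finset V}

omit [Fintype V] [DecidableEq V] in
lemma IsMoralDAG.notMem_self (h : IsMoralDAG G pa) (v : V) : v ∉ pa v :=
  fun hv => h.acyclic v (Relation.TransGen.single hv)

lemma IsAssociated.nonempty_cells (hp : IsAssociated G p μ) : Nonempty (∀ v, I v) := by
  by_contra h
  rw [not_nonempty_iff] at h
  obtain ⟨ω, hω⟩ := hp.sum_eq_one.exists
  simp at hω

omit [IsProbabilityMeasure μ] in
lemma IsAssociated.rep (hp : IsAssociated G p μ) (hpa : IsMoralDAG G pa) :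
    ∀ᵐ ω ∂μ, ∀ i, p ω i = ∏ v, condParam (p ω) pa v (fun w => i w) (i v) := by
  filter_upwards [hp.pos, hp.sum_eq_one, hp.markov] with ω h1 h2 h3
  exact h3.eq_prod_condParam h1 h2 hpa

omit [IsProbabilityMeasure μ] in
lemma IsAssociated.measurable_condParam (hp : IsAssociated G p μ) (v : V) (k : ∀ w : pa v, I w) :
    Measurable fun ω => condParam (p ω) pa v k :=
  (PDirichlet.measurable_condParam pa v k).comp hp.measurable

-- Independence between the vertices and independence within each vertex combine into independence
-- of the whole doubly indexed family.
omit [IsProbabilityMeasure μ] in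
lemma ParameterIndependence.iIndepFun_sigma (hp : IsAssociated G p μ)
    (hind : ParameterIndependence pa p μ) :
    iIndepFun (fun (x : Σ v, ∀ w : pa v, I w) ω => condParam (p ω) pa x.1 x.2) μ :=
  iIndepFun_uncurry (X := fun v k ω => condParam (p ω) pa v k)
    (fun v k => hp.measurable_condParam v k) hind.2.1 fun v => (hind.1 v).1

/-- The distribution of the random vector `(ℙ (X v = m | X_{pa v} = k))_m`. -/
noncomputable def condLaw (p : Ω → (∀ v, I v) → ℝ) (μ : Measure Ω) (pa : V → Finset V) (v : V)
    (k : ∀ w : pa v, I w) : Measure (I v → ℝ) :=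
  μ.map fun ω => condParam (p ω) pa v k

lemma IsAssociated.isProbabilityMeasure_condLaw (hp : IsAssociated G p μ) (v : V)
    (k : ∀ w : pa v, I w) : IsProbabilityMeasure (condLaw p μ pa v k) :=
  Measure.isProbabilityMeasure_map (hp.measurable_condParam v k).aemeasurable

lemma IsAssociated.ae_condLaw (hp : IsAssociated G p μ) (hpa : IsMoralDAG G pa) (v : V)
    (k : ∀ w : pa v, I w) :
    ∀ᵐ y ∂condLaw p μ pa v k, (∀ m, 0 < y m) ∧ ∑ m, y m = 1 := by
  have := hp.nonempty_cells
  rw [condLaw, ae_map_iff (hp.measurable_condParam v k).aemeasurable (measurableSet_simplex _)]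
  filter_upwards [hp.pos] with ω hω
  exact condParam_mem_simplex hω (hpa.notMem_self v) k

omit [IsProbabilityMeasure μ] in
lemma moment_condLaw (hp : IsAssociated G p μ) (v : V) (k : ∀ w : pa v, I w) (r : I v → ℕ) :
    moment (condLaw p μ pa v k) r = ∫ ω, ∏ m, condParam (p ω) pa v k m ^ r m ∂μ := by
  rw [moment, condLaw, integral_map (hp.measurable_condParam v k).aemeasurable
    (measurable_monomial r).aestronglyMeasurable]

omit [IsProbabilityMeasure μ] in
lemma nondegenerate_condLaw (hp : IsAssociated G p μ) (hind : ParameterIndependence pa p μ) (v : V)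
    (k : ∀ w : pa v, I w) : ¬ ∃ c, ∀ᵐ y ∂condLaw p μ pa v k, y = c := by
  rintro ⟨c, hc⟩
  exact (hind.1 v).2 k ⟨c, ae_of_ae_map (hp.measurable_condParam v k).aemeasurable hc⟩

variable [∀ v, DecidableEq (I v)]

omit [IsProbabilityMeasure μ] in
/-- The joint moments of the cell probabilities factorize along a DAG for which parameter
independence holds. -/
lemma integral_prod_pow_eq_prod_moment (hp : IsAssociated G p μ) (hpa : IsMoralDAG G pa)
    (hind : ParameterIndependence pa p μ) (n : (∀ v, I v) → ℕ) :
    ∫ ω, ∏ i, p ω i ^ n i ∂μ =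
      ∏ x : Σ v, ∀ w : pa v, I w, moment (condLaw p μ pa x.1 x.2) (parentCount pa x.1 x.2 n) := by
  simp_rw [moment_condLaw hp]
  have h := (hind.iIndepFun_sigma hp).integral_fun_prod_comp
    (f := fun x y => ∏ m, y m ^ parentCount pa x.1 x.2 n m)
    (fun x => (hp.measurable_condParam x.1 x.2).aemeasurable)
    (fun x => (measurable_monomial (parentCount pa x.1 x.2 n)).aestronglyMeasurable)
  rw [← h]
  refine integral_congr_ae ?_
  filter_upwards [hp.rep hpa] with ω hω
  rw [Fintype.prod_sigma]
  rw [Finset.prod_congr rfl fun i _ => by rw [hω i, ← Finset.prod_pow], Finset.prod_comm]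
  refine Finset.prod_congr rfl fun v _ => ?_
  -- After the products are exchanged, the cell `i` contributes at `v` only through its own parent
  -- configuration and its own value `i v`.
  simp_rw [parentCount_apply, ← Finset.prod_pow_eq_pow_sum]
  rw [Finset.prod_congr rfl fun k _ => Finset.prod_comm, Finset.prod_comm]
  refine Finset.prod_congr rfl fun i _ => ?_
  rw [Finset.prod_eq_single (fun w : pa v => i w), Finset.prod_eq_single (i v)]
  · simp
  · intro m _ hm
    simp [hm.symm]
  · simp
  · intro k _ hk
    simp [hk.symm]
  · simp

/-- The left side does not mention `pa`, so evaluations along two DAGs can be equated. -/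
lemma exists_crossRatio_moment (hp : IsAssociated G p μ) (hpa : IsMoralDAG G pa)
    (hind : ParameterIndependence pa p μ) (v : V) (x y : ∀ v, I v) :
    ∃ C : ℕ → ℝ, (∀ N, 0 < C N) ∧ ∀ (r : I v → ℕ) (m m' : I v), m ≠ m' →
      crossRatio (fun n => ∫ ω, ∏ i, p ω i ^ n i ∂μ)
        (sliceCount x v r) (Pi.single (Function.update x v m) 1)
        (Pi.single (Function.update y v m') 1) =
      (if ∀ w ∈ pa v, x w = y w then
        crossRatio (moment (condLaw p μ pa v fun w => x w)) r (Pi.single m 1) (Pi.single m' 1)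
        else 1) * C (∑ l, r l) := by
  rw [funext (integral_prod_pow_eq_prod_moment hp hpa hind)]
  refine exists_crossRatio_sliceCount hpa.notMem_self
    (f := fun x => moment (condLaw p μ pa x.1 x.2)) (fun x r => ?_) v x y
  have := hp.isProbabilityMeasure_condLaw x.1 x.2
  exact moment_pos (hp.ae_condLaw hpa x.1 x.2) r

/-- Take `y` equal to `x` exactly on `pa v`. Along `pa` the law at `v` enters the cross ratio of the
joint moments; along `pa'` it does not, since `x` and `y` differ at a vertex of `pa' v` outside `pa
v`. Only functions of the degree remain. -/
lemma exists_crossRatio_of_not_subset (hp : IsAssociated G p μ) (hpa : IsMoralDAG G pa)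
    (hind : ParameterIndependence pa p μ) (hpa' : IsMoralDAG G pa')
    (hind' : ParameterIndependence pa' p μ) {v : V} (hv : ¬ pa' v ⊆ pa v) (x : ∀ v, I v) :
    ∃ H : ℕ → ℝ, ∀ (r : I v → ℕ) m m', m ≠ m' →
      crossRatio (moment (condLaw p μ pa v fun w => x w)) r (Pi.single m 1) (Pi.single m' 1) =
        H (∑ l, r l) := by
  -- Non-degeneracy at every vertex provides the values different from those of `x` that are used to
  -- build `y`.
  have hnt : ∀ w, Nontrivial (I w) := fun w =>
    nontrivial_of_nondegenerate (hp.ae_condLaw hpa w fun u => x u)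
      (nondegenerate_condLaw hp hind w _)
  choose z hz using fun w => exists_ne (x w)
  let y : ∀ v, I v := fun w => if w ∈ pa v then x w else z w
  obtain ⟨C, hC, h⟩ := exists_crossRatio_moment hp hpa hind v x y
  obtain ⟨C', -, h'⟩ := exists_crossRatio_moment hp hpa' hind' v x y
  refine ⟨fun N => C' N / C N, fun r m m' hm => ?_⟩
  have h1 := h r m m' hm
  rw [h' r m m' hm, if_pos (c := ∀ w ∈ pa v, x w = y w)
    (fun w hw => by simp [y, hw]), if_neg, one_mul] at h1
  · rw [eq_div_iff (hC _).ne', h1]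
  · obtain ⟨u, hu', hu⟩ := Finset.not_subset.1 hv
    intro hxy
    have := hxy u hu'
    simp only [y, if_neg hu] at this
    exact hz u this.symm

/-- If `pa' v` is strictly contained in `pa v`, the previous argument applies to `pa'` instead. The
choice `y = x` then carries the result back, since the cross ratios of the two conditional laws at
`v` agree up to a function of the degree. -/
lemma exists_crossRatio_of_ne (hp : IsAssociated G p μ) (hpa : IsMoralDAG G pa)
    (hind : ParameterIndependence pa p μ) (hpa' : IsMoralDAG G pa')
    (hind' : ParameterIndependence pa' p μ) {v : V} (hv : pa v ≠ pa' v) (x : ∀ v, I v) :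
    ∃ H : ℕ → ℝ, ∀ (r : I v → ℕ) m m', m ≠ m' →
      crossRatio (moment (condLaw p μ pa v fun w => x w)) r (Pi.single m 1) (Pi.single m' 1) =
        H (∑ l, r l) := by
  by_cases hsub : pa' v ⊆ pa v
  · obtain ⟨H, hH⟩ := exists_crossRatio_of_not_subset hp hpa' hind' hpa hind
      (fun hsub' => hv (hsub'.antisymm hsub)) x
    obtain ⟨C, hC, h⟩ := exists_crossRatio_moment hp hpa hind v x x
    obtain ⟨C', -, h'⟩ := exists_crossRatio_moment hp hpa' hind' v x x
    refine ⟨fun N => H N * C' N / C N, fun r m m' hm => ?_⟩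
    have h1 := h r m m' hm
    rw [h' r m m' hm, if_pos (fun _ _ => rfl), if_pos (fun _ _ => rfl), hH r m m' hm] at h1
    rw [eq_div_iff (hC _).ne', h1]
  · exact exists_crossRatio_of_not_subset hp hpa hind hpa' hind' hsub x

/-- Parameter independence for two DAGs which give different parents to `v` forces the conditional
distributions at `v` to be Dirichlet. -/
theorem isDirichlet_condLaw (hp : IsAssociated G p μ) (hpa : IsMoralDAG G pa)
    (hind : ParameterIndependence pa p μ) (hpa' : IsMoralDAG G pa')
    (hind' : ParameterIndependence pa' p μ) {v : V} (hv : pa v ≠ pa' v) (k : ∀ w : pa v, I w) :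
    IsDirichlet (condLaw p μ pa v k) := by
  have := hp.nonempty_cells
  obtain ⟨x, rfl, -⟩ := exists_cell (hpa.notMem_self v) k (Classical.arbitrary (∀ v, I v) v)
  obtain ⟨H, hH⟩ := exists_crossRatio_of_ne hp hpa hind hpa' hind' hv x
  have := hp.isProbabilityMeasure_condLaw v fun w : pa v => x w
  exact isDirichlet_of_crossRatio (hp.ae_condLaw hpa v _) (nondegenerate_condLaw hp hind v _) hH

end Main

end PDirichlet

theorem mainTheorem1 {V : Type*} [Fintype V] [DecidableEq V]
    {I : V → Type*} [∀ v, Fintype (I v)] [∀ v, DecidableEq (I v)]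
    {Ω : Type*} [MeasurableSpace Ω] (μ : Measure Ω) [IsProbabilityMeasure μ]
    (G : SimpleGraph V) (hG : PDirichlet.IsDecomposable G)
    (P : Set (V → Finset V)) (hP : ∀ pa ∈ P, PDirichlet.IsMoralDAG G pa)
    (hsep : PDirichlet.IsSeparating P)
    (p : Ω → (∀ v, I v) → ℝ) (hp : PDirichlet.IsAssociated G p μ)
    (hind : ∀ pa ∈ P, PDirichlet.ParameterIndependence pa p μ) :
    PDirichlet.IsFamilyDirichlet G P p μ := by
  intro pa hpa
  refine ⟨hp, hp.rep (hP pa hpa), (hind pa hpa).iIndepFun_sigma hp, fun v k => ?_⟩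
  obtain ⟨pa₁, h₁, pa₂, h₂, hne⟩ := hsep v
  -- Of two members with different parents of `v`, at least one differs from `pa` at `v`.
  by_cases h : pa v = pa₁ v
  · exact PDirichlet.isDirichlet_condLaw hp (hP pa hpa) (hind pa hpa) (hP pa₂ h₂) (hind pa₂ h₂)
      (h.trans_ne hne) k
  · exact PDirichlet.isDirichlet_condLaw hp (hP pa hpa) (hind pa hpa) (hP pa₁ h₁) (hind pa₁ h₁) h k
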